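/- Let $(X,\mathcal M,\mu)$ be a complete, $\sigma$-finite (positive) measure space such that $L^2(X)=L^2(X,\mu;\mathbb C)$ is separable, and let $\mathcal H$ be a separable complex Hilbert space. For $\phi\in L^\infty(X)$ let $M_\phi$ be the operator $(M_\phi f)(x)=\phi(x)f(x)$ on $L^2(X;\mathcal H)$. A closed subspace $V\subset L^2(X;\mathcal H)$ is called multiplication-invariant (MI) if $M_\phi V\subset V$ for all $\phi\in L^\infty(X)$. A bounded linear operator $T\colon V\to V'$ between MI spaces is an MI operator if $TM_\phi=M_\phi T$ for all $\phi\in L^\infty(X)$; an MI isomorphism (resp. MI isometric isomorphism) is an MI operator that is a linear bijection with bounded inverse (resp. a surjective linear isometry). A range function of an MI space $V$ is a map $J$ from $X$ to the closed subspaces of $\mathcal H$ such that, with $P_J(x)$ the orthogonal projection onto $J(x)$, the function $x\mapsto\langle P_J(x)u,v\rangle$ is measurable for all $u,v\in\mathcal H$, and such that $$V=\{f\in L^2(X;\mathcal H): f(x)\in J(x)\text{ for a.e. }x\in X\}.$$ The dimension function of $V$ is $\dim_V(x)=\dim J(x)\in\mathbb N\cup\{0,\infty\}$, $x\in X$. Let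 $V,V'\subset L^2(X;\mathcal H)$ be MI spaces. Then $V$ and $V'$ have range functions, so that $\dim_V$ and $\dim_{V'}$ exist, and for every choice of these range functions the following are equivalent: 1. $\dim_V(x)=\dim_{V'}(x)$ for a.e. $x\in X$; 2. there exists an MI isometric isomorphism $T\colon V\to V'$; 3. there exists an MI isomorphism $T\colon V\to V'$. -/

import Mathlib

open MeasureTheory
open scoped ENNReal

/-- A multiplication-invariant (MI) space: a closed subspace `V` of `L²(X;H)` such that
`M_φ V ⊆ V` for every `φ ∈ L^∞(X)`. Here `φ • f` is the element `x ↦ φ x • f x` of `L²(X;H)`. -/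
def IsMISpace {X : Type*} [MeasurableSpace X] {μ : Measure X}
    {H : Type*} [NormedAddCommGroup H] [InnerProductSpace ℂ H]
    (V : Submodule ℂ (Lp H 2 μ)) : Prop :=
  IsClosed (V : Set (Lp H 2 μ)) ∧
    ∀ (φ : Lp ℂ ∞ μ) (f : Lp H 2 μ), f ∈ V → (φ • f : Lp H 2 μ) ∈ V

/-- The operator `M_φ` of multiplication by `φ ∈ L^∞(X)` on an MI space `V`. -/
noncomputable def IsMISpace.mul {X : Type*} [MeasurableSpace X] {μ : Measure X}
    {H : Type*} [NormedAddCommGroup H] [InnerProductSpace ℂ H]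
    {V : Submodule ℂ (Lp H 2 μ)} (hV : IsMISpace V) (φ : Lp ℂ ∞ μ) (f : V) : V :=
  ⟨φ • (f : Lp H 2 μ), hV.2 φ f f.2⟩

/-- A bounded linear operator `T : V → V'` between MI spaces is an MI operator when
`T M_φ = M_φ T` for every `φ ∈ L^∞(X)`. -/
def IsMIOperator {X : Type*} [MeasurableSpace X] {μ : Measure X}
    {H H' : Type*} [NormedAddCommGroup H] [InnerProductSpace ℂ H]
    [NormedAddCommGroup H'] [InnerProductSpace ℂ H']
    {V : Submodule ℂ (Lp H 2 μ)} {V' : Submodule ℂ (Lp H' 2 μ)}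
    (hV : IsMISpace V) (hV' : IsMISpace V') (T : V →L[ℂ] V') : Prop :=
  ∀ (φ : Lp ℂ ∞ μ) (f : V), T (hV.mul φ f) = hV'.mul φ (T f)

/-- A range function `J`, i.e. a map from `X` to the closed subspaces of `H`, is measurable when
`x ↦ ⟨P_J(x) u, v⟩` is measurable for all `u, v ∈ H`, where `P_J(x)` is the orthogonal projection
onto `J(x)`. (Mathlib's inner product is conjugate-linear
in the first variable.) -/
def MeasurableRangeFunction {X : Type*} [MeasurableSpace X]
    {H : Type*} [NormedAddCommGroup H] [InnerProductSpace ℂ H] [CompleteSpace H]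
    (J : X → ClosedSubmodule ℂ H) : Prop :=
  ∀ u v : H, Measurable fun x => inner ℂ v ((J x).toSubmodule.starProjection u)

/-- `J` is a range function of `V`: `J` is a measurable range function and
`V = V_J = {f ∈ L²(X;H) : f x ∈ J x for a.e. x}`. -/
def IsRangeFunctionOf {X : Type*} [MeasurableSpace X] {μ : Measure X}
    {H : Type*} [NormedAddCommGroup H] [InnerProductSpace ℂ H] [CompleteSpace H]
    (J : X → ClosedSubmodule ℂ H) (V : Submodule ℂ (Lp H 2 μ)) : Prop :=
  MeasurableRangeFunction J ∧ ∀ f : Lp H 2 μ, f ∈ V ↔ ∀ᵐ x ∂μ, f x ∈ J x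

/-- `d` is (a version of) the dimension function of `V`: `d x = dim J(x) ∈ {0, 1, 2, …, ∞}` for a
range function `J` of `V`. All infinite dimensions are recorded as `∞`. -/
def IsDimensionFunctionOf {X : Type*} [MeasurableSpace X] {μ : Measure X}
    {H : Type*} [NormedAddCommGroup H] [InnerProductSpace ℂ H] [CompleteSpace H]
    (d : X → ℕ∞) (V : Submodule ℂ (Lp H 2 μ)) : Prop :=
  ∃ J : X → ClosedSubmodule ℂ H, IsRangeFunctionOf J V ∧
    ∀ x, d x = Cardinal.toENat (Module.rank ℂ (J x).toSubmodule)

/-! An MI space is determined fibrewise, and `L^∞`-linearity lets Hilbert space statements be tested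
fibre by fibre: multiplying by indicators turns orthogonality and norm bounds in `L²` into almost
everywhere pointwise ones (`ae_inner_eq_zero_of_forall_indicator`, `IsMIOperator.ae_norm_le`).

Range functions: project onto `V` a sequence of fields that is total in every fibre, and let `J x`
be the closed span of the values at `x`. The inclusion `V_J ⊆ V` holds because a vector orthogonal
to `V` is pointwise orthogonal to `J`. For the converse, the part of `f ∈ V` pointwise orthogonal to
`J` is orthogonal to all localized test fields, hence zero.

Equal dimensions give an isometry: Gram–Schmidt applied pointwise yields measurable orthonormal
bases `e n x` of `J x`, padded by zeros at the end, so `e n x ≠ 0` exactly when `dim J x ≥ n + 1`.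
Matching `e n x` with `e' n x` defines unitaries `J x → J' x`, which act on `L²` and commute with
multiplications.

An isomorphism gives equal dimensions: the pointwise bound for `T⁻¹` shows that `T` carries a basis
field of `J` to pointwise independent vectors of `J'`, so `dim J ≤ dim J'`; symmetry gives equality.
-/

/-- A sequence whose nonzero terms form an initial segment and are orthonormal. -/
structure IsInitialOrthonormal {H : Type*} [NormedAddCommGroup H] [InnerProductSpace ℂ H]
    (e : ℕ → H) : Prop where
  inner_eq_zero : ∀ m n, m ≠ n → inner ℂ (e m) (e n) = 0
  norm_eq_one : ∀ n, e n ≠ 0 → ‖e n‖ = 1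
  eq_zero_of_le : ∀ m n, m ≤ n → e m = 0 → e n = 0

/-! ### Gram–Schmidt that skips dependent terms, and its measurability. -/

namespace GreedyOrthonormal

variable {H : Type*} [NormedAddCommGroup H] [InnerProductSpace ℂ H]

open Classical in
/-- The first nonzero term of a sequence, or `0` if there is none. -/
noncomputable def firstNonzero (v : ℕ → H) : H :=
  if h : ∃ k, v k ≠ 0 then v (Nat.find h) else 0

/-- The normalization of the first nonzero term. -/
noncomputable def pivot (v : ℕ → H) : H :=
  ((‖firstNonzero v‖⁻¹ : ℝ) : ℂ) • firstNonzero v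

/-- Subtract from every term its component along the pivot. -/
noncomputable def reduce (v : ℕ → H) : ℕ → H :=
  fun k => v k - inner ℂ (pivot v) (v k) • pivot v

/-- Gram–Schmidt orthonormalization which skips the linearly dependent terms. -/
noncomputable def basis (v : ℕ → H) (n : ℕ) : H := pivot (reduce^[n] v)

omit [InnerProductSpace ℂ H] in
lemma firstNonzero_mem_range (v : ℕ → H) (h : ∃ k, v k ≠ 0) :
    ∃ k, firstNonzero v = v k ∧ v k ≠ 0 ∧ ∀ j < k, v j = 0 := by
  classical
  refine ⟨Nat.find h, ?_, Nat.find_spec h, fun j hj => ?_⟩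
  · simp only [firstNonzero, dif_pos h]
  · simpa using Nat.find_min h hj

lemma pivot_eq_zero {v : ℕ → H} (h : ∀ k, v k = 0) : pivot v = 0 := by
  simp [pivot, firstNonzero, h]

lemma exists_pivot_eq (v : ℕ → H) (h : ∃ k, v k ≠ 0) :
    ∃ k, pivot v = ((‖v k‖⁻¹ : ℝ) : ℂ) • v k ∧ v k ≠ 0 ∧ ∀ j < k, v j = 0 := by
  obtain ⟨k, h1, h2, h3⟩ := firstNonzero_mem_range v h
  exact ⟨k, by rw [pivot, h1], h2, h3⟩

lemma norm_pivot {v : ℕ → H} (h : ∃ k, v k ≠ 0) : ‖pivot v‖ = 1 := by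
  obtain ⟨k, h1, h2, -⟩ := exists_pivot_eq v h
  rw [h1, norm_smul]
  simp [h2]

lemma pivot_eq_zero_iff {v : ℕ → H} : pivot v = 0 ↔ ∀ k, v k = 0 := by
  refine ⟨fun h => ?_, pivot_eq_zero⟩
  by_contra! hne
  have := norm_pivot hne
  simp [h] at this

lemma pivot_mem {v : ℕ → H} {K : Submodule ℂ H} (h : ∀ k, v k ∈ K) : pivot v ∈ K := by
  by_cases hne : ∃ k, v k ≠ 0
  · obtain ⟨k, h1, -, -⟩ := exists_pivot_eq v hne
    rw [h1]
    exact K.smul_mem _ (h k)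
  · push Not at hne
    rw [pivot_eq_zero hne]
    exact K.zero_mem

lemma reduce_mem {v : ℕ → H} {K : Submodule ℂ H} (h : ∀ k, v k ∈ K) (k : ℕ) :
    reduce v k ∈ K :=
  K.sub_mem (h k) (K.smul_mem _ (pivot_mem h))

/-- Used with three choices of `K`: the span of `v`, the orthogonal complement of an earlier basis
vector (for orthogonality), and `⊥` (once everything is zero, it stays zero). -/
lemma iterate_reduce_mem {v : ℕ → H} {K : Submodule ℂ H} (h : ∀ k, v k ∈ K) (n k : ℕ) :
    reduce^[n] v k ∈ K := by
  induction n generalizing v with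
  | zero => exact h k
  | succ n ih => exact ih (fun k => reduce_mem h k)

lemma inner_pivot_reduce (v : ℕ → H) (k : ℕ) : inner ℂ (pivot v) (reduce v k) = 0 := by
  by_cases hne : ∃ k, v k ≠ 0
  · have h1 : inner ℂ (pivot v) (pivot v) = (1 : ℂ) := by
      rw [inner_self_eq_norm_sq_to_K, norm_pivot hne]; simp
    rw [reduce, inner_sub_right, inner_smul_right, h1, mul_one, sub_self]
  · push Not at hne
    rw [pivot_eq_zero hne, inner_zero_left]

/-- Each round kills one more index: if `v m ≠ 0`, it is the first nonzero term, so it is a multiple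
of the pivot and is removed entirely. -/
lemma reduce_eq_zero {v : ℕ → H} {m : ℕ} (h : ∀ j < m, v j = 0) : ∀ j < m + 1, reduce v j = 0 := by
  intro j hj
  by_cases hjm : v j = 0
  · simp [reduce, hjm]
  have hjm' : j = m := by
    by_contra hne
    exact hjm (h j (by omega))
  subst hjm'
  obtain ⟨k, h1, h2, h3⟩ := exists_pivot_eq v ⟨j, hjm⟩
  have hk : k = j := by
    rcases lt_trichotomy k j with hlt | heq | hgt
    · exact absurd (h k hlt) h2
    · exact heq
    · exact absurd (h3 j hgt) hjm
  subst hk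
  have hn : (‖v k‖ : ℂ) ≠ 0 := by simpa using h2
  have hc : (‖v k‖⁻¹ : ℂ) * (‖v k‖ : ℂ) ^ 2 * (‖v k‖⁻¹ : ℂ) = 1 := by field_simp
  rw [reduce, h1, inner_smul_left, inner_self_eq_norm_sq_to_K, smul_smul]
  simp only [map_inv₀, Complex.conj_ofReal, Complex.ofReal_inv, Complex.coe_algebraMap] at hc ⊢
  rw [hc, one_smul, sub_self]

lemma iterate_reduce_eq_zero (v : ℕ → H) (n : ℕ) : ∀ j < n, reduce^[n] v j = 0 := by
  induction n with
  | zero => simp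
  | succ n ih =>
    rw [Function.iterate_succ_apply']
    exact reduce_eq_zero ih

lemma inner_basis_iterate (v : ℕ → H) (m n k : ℕ) (h : m < n) :
    inner ℂ (basis v m) (reduce^[n] v k) = 0 := by
  have hmem : ∀ k, reduce^[m + 1] v k ∈ (ℂ ∙ basis v m)ᗮ := fun k => by
    rw [Submodule.mem_orthogonal_singleton_iff_inner_right, Function.iterate_succ_apply']
    exact inner_pivot_reduce _ k
  obtain ⟨d, rfl⟩ := Nat.exists_eq_add_of_lt h
  have := iterate_reduce_mem hmem d k
  rw [← Function.iterate_add_apply, Submodule.mem_orthogonal_singleton_iff_inner_right] at this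
  rwa [show m + d + 1 = d + (m + 1) by ring]

lemma inner_basis_of_lt (v : ℕ → H) {m n : ℕ} (h : m < n) :
    inner ℂ (basis v m) (basis v n) = 0 := by
  have : basis v n ∈ (ℂ ∙ basis v m)ᗮ := pivot_mem fun k => by
    rw [Submodule.mem_orthogonal_singleton_iff_inner_right]
    exact inner_basis_iterate v m n k h
  rwa [Submodule.mem_orthogonal_singleton_iff_inner_right] at this

/-- The subtracted components telescope. At `n = k + 1` the reduced term is zero, which puts `v k`
itself in the span. -/
lemma sub_iterate_reduce_mem (v : ℕ → H) (n k : ℕ) :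
    v k - reduce^[n] v k ∈ Submodule.span ℂ (Set.range (basis v)) := by
  induction n with
  | zero => simp
  | succ n ih =>
    have h : v k - reduce^[n + 1] v k = (v k - reduce^[n] v k) +
        inner ℂ (basis v n) (reduce^[n] v k) • basis v n := by
      rw [Function.iterate_succ_apply', reduce, basis]
      abel
    rw [h]
    exact Submodule.add_mem _ ih (Submodule.smul_mem _ _ (Submodule.subset_span ⟨n, rfl⟩))

lemma span_basis (v : ℕ → H) :
    Submodule.span ℂ (Set.range (basis v)) = Submodule.span ℂ (Set.range v) := by
  refine le_antisymm (Submodule.span_le.2 ?_) (Submodule.span_le.2 ?_)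
  · rintro _ ⟨n, rfl⟩
    exact pivot_mem fun k =>
      iterate_reduce_mem (fun j => Submodule.subset_span (Set.mem_range_self j)) n k
  · rintro _ ⟨k, rfl⟩
    have := sub_iterate_reduce_mem v (k + 1) k
    rwa [iterate_reduce_eq_zero v (k + 1) k (Nat.lt_succ_self k), sub_zero] at this

lemma isInitialOrthonormal_basis (v : ℕ → H) : IsInitialOrthonormal (basis v) where
  inner_eq_zero m n hmn := by
    rcases lt_or_gt_of_ne hmn with h | h
    · exact inner_basis_of_lt v h
    · exact inner_eq_zero_symm.1 (inner_basis_of_lt v h)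
  norm_eq_one n hn := by
    refine norm_pivot ?_
    by_contra! h
    exact hn (pivot_eq_zero h)
  eq_zero_of_le m n hmn h := by
    have h0 : ∀ k, reduce^[m] v k ∈ (⊥ : Submodule ℂ H) := pivot_eq_zero_iff.1 h
    obtain ⟨d, rfl⟩ := Nat.exists_eq_add_of_le hmn
    refine pivot_eq_zero fun k => ?_
    rw [add_comm m d, Function.iterate_add_apply]
    exact iterate_reduce_mem h0 d k

section Measurability

variable [MeasurableSpace H] [BorelSpace H] [SecondCountableTopology H]
  {X : Type*} [MeasurableSpace X]

omit [InnerProductSpace ℂ H] in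
lemma measurable_firstNonzero {v : X → ℕ → H} (hv : ∀ k, Measurable fun x => v x k) :
    Measurable fun x => firstNonzero (v x) := by
  classical
  have hset : ∀ k, MeasurableSet {x | v x k ≠ 0} := fun k =>
    (hv k (measurableSet_singleton 0)).compl
  let w : ℕ → X → H := fun k x => v x k
  -- The default index `0` is harmless: it is used only when all terms vanish, and then `v x 0 = 0`
  -- is the correct value.
  have hf : Measurable fun x => if h : ∃ k, v x k ≠ 0 then Nat.find h else 0 := by
    refine measurable_to_countable' fun n => ?_
    have : (fun x => if h : ∃ k, v x k ≠ 0 then Nat.find h else 0) ⁻¹' {n} =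
        ({x | v x n ≠ 0} ∩ ⋂ j < n, {x | v x j ≠ 0}ᶜ) ∪
          ({x | n = 0} ∩ ⋂ j, {x | v x j ≠ 0}ᶜ) := by
      ext x
      by_cases h : ∃ k, v x k ≠ 0
      · have h' : ¬ ∀ k, v x k = 0 := by push Not; exact h
        simp [h, Nat.find_eq_iff, h']
      · push Not at h
        simp [h, eq_comm]
    rw [this]
    refine ((hset n).inter (MeasurableSet.iInter fun j => MeasurableSet.iInter fun _ =>
      (hset j).compl)).union ((MeasurableSet.const _).inter
        (MeasurableSet.iInter fun j => (hset j).compl))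
  have : (fun x => firstNonzero (v x)) =
      fun x => w (if h : ∃ k, v x k ≠ 0 then Nat.find h else 0) x := by
    ext x
    by_cases h : ∃ k, v x k ≠ 0
    · simp only [firstNonzero, dif_pos h, w]
    · simp only [firstNonzero, dif_neg h, w]
      push Not at h
      exact (h 0).symm
  rw [this]
  exact (measurable_from_prod_countable_right (f := fun p : ℕ × X => w p.1 p.2) hv).comp
    (hf.prodMk measurable_id)

lemma measurable_pivot {v : X → ℕ → H} (hv : ∀ k, Measurable fun x => v x k) :
    Measurable fun x => pivot (v x) := by
  have := measurable_firstNonzero hv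
  exact (Complex.measurable_ofReal.comp this.norm.inv).smul this

lemma measurable_reduce {v : X → ℕ → H} (hv : ∀ k, Measurable fun x => v x k) (k : ℕ) :
    Measurable fun x => reduce (v x) k := by
  have := measurable_pivot hv
  exact (hv k).sub ((this.inner (hv k)).smul this)

lemma measurable_basis {v : X → ℕ → H} (hv : ∀ k, Measurable fun x => v x k) (n : ℕ) :
    Measurable fun x => basis (v x) n := by
  refine measurable_pivot fun k => ?_
  induction n generalizing k with
  | zero => exact hv k
  | succ n ih =>
    simp only [Function.iterate_succ_apply']
    exact measurable_reduce ih k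

end Measurability

end GreedyOrthonormal

/-! ### Expansions, projections and partial isometries for padded orthonormal sequences. -/

namespace IsInitialOrthonormal

variable {H : Type*} [NormedAddCommGroup H] [InnerProductSpace ℂ H] {e e' : ℕ → H}

lemma orthonormal (he : IsInitialOrthonormal e) {S : Set ℕ} (hS : ∀ n ∈ S, e n ≠ 0) :
    Orthonormal ℂ fun n : S => e n :=
  ⟨fun n => he.norm_eq_one n (hS n n.2),
    fun m n hmn => he.inner_eq_zero m n fun h => hmn (Subtype.ext h)⟩

variable [CompleteSpace H]

/-- The isometry of `ℓ²` onto the closed span of the nonzero terms, together with the expansion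
of its adjoint. -/
lemma exists_isometry (he : IsInitialOrthonormal e) {S : Set ℕ} (hS : ∀ n, n ∈ S ↔ e n ≠ 0) :
    ∃ L : lp (fun _ : S => ℂ) 2 →ₗᵢ[ℂ] H,
      (∀ h, h ∈ (Submodule.span ℂ (Set.range e)).topologicalClosure ↔ ∃ z, L z = h) ∧
      (∀ z, HasSum (fun n : S => z n • e n) (L z)) ∧
      ∀ (h : H) (n : S), (ContinuousLinearMap.adjoint L.toContinuousLinearMap h) n =
        inner ℂ (e n) h := by
  classical
  have ho := he.orthonormal fun n hn => (hS n).1 hn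
  refine ⟨ho.orthogonalFamily.linearIsometry, fun h => ?_, fun z => ?_, fun h n => ?_⟩
  · have hspan : Submodule.span ℂ (Set.range e) =
        Submodule.span ℂ (Set.range fun n : S => e n) := by
      refine le_antisymm (Submodule.span_le.2 ?_) (Submodule.span_mono ?_)
      · rintro _ ⟨n, rfl⟩
        by_cases hn : e n = 0
        · rw [hn]; exact Submodule.zero_mem _
        · exact Submodule.subset_span ⟨⟨n, (hS n).2 hn⟩, rfl⟩
      · rintro _ ⟨n, rfl⟩
        exact ⟨n, rfl⟩
    have hr := ho.orthogonalFamily.range_linearIsometry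
    have hsup : (⨆ i : S, LinearMap.range
        (LinearIsometry.toSpanSingleton ℂ H (ho.1 i)).toLinearMap) =
        Submodule.span ℂ (Set.range e) := by
      rw [hspan, Submodule.span_range_eq_iSup]
      refine iSup_congr fun i => ?_
      ext y
      simp [Submodule.mem_span_singleton]
    rw [← hsup]
    erw [← hr]
    rfl
  · exact ho.orthogonalFamily.hasSum_linearIsometry z
  · have h1 : inner ℂ (lp.single 2 n (1 : ℂ) : lp (fun _ : S => ℂ) 2)
        (ContinuousLinearMap.adjoint
          ho.orthogonalFamily.linearIsometry.toContinuousLinearMap h) = inner ℂ (e n) h := by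
      rw [ContinuousLinearMap.adjoint_inner_right]
      simp
    rw [lp.inner_single_left] at h1
    simpa using h1

omit [CompleteSpace H] in
lemma hasSum_nat {S : Set ℕ} (hS : ∀ n, n ∈ S ↔ e n ≠ 0) {h a : H}
    (hs : HasSum (fun n : S => inner ℂ (e n) h • e' n) a) :
    HasSum (fun n => inner ℂ (e n) h • e' n) a := by
  refine (hasSum_subtype_iff_of_support_subset (s := S) fun n hn => ?_).1 hs
  rw [hS]
  rintro h0
  simp [h0] at hn

/-- The expansion of the orthogonal projection onto the closed span. -/
lemma hasSum_starProjection (he : IsInitialOrthonormal e) {K : Submodule ℂ H}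
    [K.HasOrthogonalProjection]
    (hK : (Submodule.span ℂ (Set.range e)).topologicalClosure = K) (h : H) :
    HasSum (fun n => inner ℂ (e n) h • e n) (K.starProjection h) := by
  obtain ⟨L, hL, hsum, hadj⟩ := he.exists_isometry (S := {n | e n ≠ 0}) fun n => Iff.rfl
  rw [hK] at hL
  -- For an isometry `L` with range `K`, the projection onto `K` is `L L*`.
  have : K.starProjection h = L (ContinuousLinearMap.adjoint L.toContinuousLinearMap h) := by
    refine Submodule.eq_starProjection_of_mem_of_inner_eq_zero ((hL _).2 ⟨_, rfl⟩) fun w hw => ?_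
    obtain ⟨z, rfl⟩ := (hL w).1 hw
    rw [inner_sub_left, L.inner_map_map, sub_eq_zero, ContinuousLinearMap.adjoint_inner_left]
    rfl
  rw [this]
  refine hasSum_nat (S := {n | e n ≠ 0}) (fun n => Iff.rfl) ?_
  simpa only [hadj] using hsum (ContinuousLinearMap.adjoint L.toContinuousLinearMap h)

/-- The partial isometries exchanging the two closed spans. -/
lemma exists_transfer (he : IsInitialOrthonormal e) (he' : IsInitialOrthonormal e')
    (hz : ∀ n, e n = 0 ↔ e' n = 0) :
    ∃ W W' : H →L[ℂ] H, (∀ h, ‖W h‖ ≤ ‖h‖) ∧ (∀ h, ‖W' h‖ ≤ ‖h‖) ∧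
      (∀ h, HasSum (fun n => inner ℂ (e n) h • e' n) (W h)) ∧
      (∀ h, HasSum (fun n => inner ℂ (e' n) h • e n) (W' h)) ∧
      (∀ h, W h ∈ (Submodule.span ℂ (Set.range e')).topologicalClosure) ∧
      (∀ h, W' h ∈ (Submodule.span ℂ (Set.range e)).topologicalClosure) ∧
      (∀ h ∈ (Submodule.span ℂ (Set.range e)).topologicalClosure, W' (W h) = h) ∧
      (∀ h ∈ (Submodule.span ℂ (Set.range e')).topologicalClosure, W (W' h) = h) := by
  have hS : ∀ n, n ∈ {n | e n ≠ 0} ↔ e n ≠ 0 := fun n => Iff.rfl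
  -- One index set serves both sequences, so `L` and `L'` start from the same `ℓ²`, and `L' L*` and
  -- `L L'*` make sense.
  have hS' : ∀ n, n ∈ {n | e n ≠ 0} ↔ e' n ≠ 0 := fun n => not_congr (hz n)
  obtain ⟨L, hL, hsum, hadj⟩ := he.exists_isometry hS
  obtain ⟨L', hL', hsum', hadj'⟩ := he'.exists_isometry hS'
  have hid : ∀ z, ContinuousLinearMap.adjoint L.toContinuousLinearMap (L z) = z := fun z =>
    congrArg (fun T => T z) L.adjoint_comp_self
  have hid' : ∀ z, ContinuousLinearMap.adjoint L'.toContinuousLinearMap (L' z) = z := fun z =>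
    congrArg (fun T => T z) L'.adjoint_comp_self
  have hnorm : ∀ (M : lp (fun _ : {n | e n ≠ 0} => ℂ) 2 →ₗᵢ[ℂ] H) (h : H),
      ‖ContinuousLinearMap.adjoint M.toContinuousLinearMap h‖ ≤ ‖h‖ := fun M h => by
    refine ContinuousLinearMap.le_of_opNorm_le_of_le _ ?_ le_rfl |>.trans_eq (one_mul _)
    rw [LinearIsometryEquiv.norm_map]
    exact M.norm_toContinuousLinearMap_le
  refine ⟨L'.toContinuousLinearMap ∘L ContinuousLinearMap.adjoint L.toContinuousLinearMap,
    L.toContinuousLinearMap ∘L ContinuousLinearMap.adjoint L'.toContinuousLinearMap,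
    fun h => ?_, fun h => ?_, fun h => ?_, fun h => ?_, fun h => ?_, fun h => ?_, ?_, ?_⟩
  · simpa using hnorm L h
  · simpa using hnorm L' h
  · refine hasSum_nat hS ?_
    have := hsum' (ContinuousLinearMap.adjoint L.toContinuousLinearMap h)
    simp only [hadj] at this
    exact this
  · refine hasSum_nat hS' ?_
    have := hsum (ContinuousLinearMap.adjoint L'.toContinuousLinearMap h)
    simp only [hadj'] at this
    exact this
  · exact (hL' _).2 ⟨_, rfl⟩
  · exact (hL _).2 ⟨_, rfl⟩
  · intro h hh
    obtain ⟨z, rfl⟩ := (hL h).1 hh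
    simp [hid, hid']
  · intro h hh
    obtain ⟨z, rfl⟩ := (hL' h).1 hh
    simp [hid, hid']

omit [CompleteSpace H] in
/-- The number of nonzero terms is the dimension of the closed span. -/
lemma ne_zero_iff_le_rank (he : IsInitialOrthonormal e) {K : Submodule ℂ H}
    (hK : (Submodule.span ℂ (Set.range e)).topologicalClosure = K) (n : ℕ) :
    e n ≠ 0 ↔ ((n + 1 : ℕ) : ℕ∞) ≤ Cardinal.toENat (Module.rank ℂ K) := by
  constructor
  · intro hn
    rw [Cardinal.natCast_le_toENat]
    have hne : ∀ i ∈ {i | i < n + 1}, e i ≠ 0 := fun i hi h =>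
      hn (he.eq_zero_of_le i n (Nat.lt_succ_iff.1 hi) h)
    have hmem : ∀ i, e i ∈ K := fun i => hK ▸
      Submodule.le_topologicalClosure _ (Submodule.subset_span ⟨i, rfl⟩)
    have hli : LinearIndependent ℂ fun i : Fin (n + 1) => (⟨e i, hmem i⟩ : K) := by
      refine LinearIndependent.of_comp K.subtype ?_
      exact (he.orthonormal hne).linearIndependent.comp
        (fun i : Fin (n + 1) => (⟨i, i.2⟩ : {i | i < n + 1}))
        fun i j hij => Fin.ext (congrArg Subtype.val hij)
    simpa using hli.cardinal_lift_le_rank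
  · classical
    intro hn h0
    have hspan : Submodule.span ℂ (Set.range e) =
        Submodule.span ℂ ((Finset.range n).image e : Set H) := by
      refine le_antisymm (Submodule.span_le.2 ?_) (Submodule.span_mono ?_)
      · rintro _ ⟨i, rfl⟩
        by_cases hi : i < n
        · exact Submodule.subset_span (by simpa using ⟨i, hi, rfl⟩)
        · rw [he.eq_zero_of_le n i (not_lt.1 hi) h0]
          exact Submodule.zero_mem _
      · intro y hy
        simp only [Finset.coe_image, Finset.coe_range] at hy
        exact Set.image_subset_range _ _ hy
    have hfin : FiniteDimensional ℂ (Submodule.span ℂ ((Finset.range n).image e : Set H)) :=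
      FiniteDimensional.span_finset ℂ _
    -- A span of `n` vectors is already closed, so taking the closure adds no dimension.
    have hK' : K = Submodule.span ℂ ((Finset.range n).image e : Set H) := by
      rw [← hK, hspan]
      exact (Submodule.closed_of_finiteDimensional _).submodule_topologicalClosure_eq
    have hle : Cardinal.toENat (Module.rank ℂ K) ≤ (n : ℕ∞) := by
      rw [Cardinal.toENat_le_natCast, hK']
      refine (rank_span_finset_le _).trans ?_
      exact_mod_cast Finset.card_image_le.trans_eq (Finset.card_range n)
    have := hn.trans hle
    norm_cast at this
    omega

end IsInitialOrthonormal

/-! ### Measurable fields of orthonormal bases. -/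

section OrthonormalFields

variable {X : Type*} [MeasurableSpace X] {H : Type*} [NormedAddCommGroup H]
  [InnerProductSpace ℂ H] [CompleteSpace H] [TopologicalSpace.SeparableSpace H]

lemma exists_isInitialOrthonormal_dense (H : Type*) [NormedAddCommGroup H]
    [InnerProductSpace ℂ H] [CompleteSpace H] [TopologicalSpace.SeparableSpace H] :
    ∃ b : ℕ → H, IsInitialOrthonormal b ∧
      (Submodule.span ℂ (Set.range b)).topologicalClosure = ⊤ := by
  refine ⟨_, GreedyOrthonormal.isInitialOrthonormal_basis (TopologicalSpace.denseSeq H), ?_⟩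
  rw [GreedyOrthonormal.span_basis, ← Submodule.dense_iff_topologicalClosure_eq_top]
  exact (TopologicalSpace.denseRange_denseSeq H).mono Submodule.subset_span

/-- Weak measurability suffices in a separable space: `f` is the pointwise limit of the partial sums
of its expansion in an orthonormal basis. -/
lemma measurable_of_inner [MeasurableSpace H] [BorelSpace H] {f : X → H}
    (hf : ∀ v, Measurable fun x => inner ℂ v (f x)) : Measurable f := by
  obtain ⟨b, hb, htop⟩ := exists_isInitialOrthonormal_dense H
  refine measurable_of_tendsto_metrizable
    (f := fun N x => ∑ n ∈ Finset.range N, inner ℂ (b n) (f x) • b n) (fun N => ?_)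
    (tendsto_pi_nhds.2 fun x => ?_)
  · exact Finset.measurable_fun_sum _ fun n _ => (hf (b n)).smul_const _
  · have := (hb.hasSum_starProjection htop (f x)).tendsto_sum_nat
    rwa [Submodule.starProjection_eq_self_iff.2 Submodule.mem_top] at this

/-- The closed spans of measurable vector fields are spanned by a measurable orthonormal field. -/
lemma exists_orthonormal_field_of_measurable [MeasurableSpace H] [BorelSpace H]
    {v : ℕ → X → H} (hv : ∀ k, Measurable (v k)) :
    ∃ e : ℕ → X → H, (∀ n, Measurable (e n)) ∧ ∀ x, IsInitialOrthonormal (fun n => e n x) ∧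
      Submodule.span ℂ (Set.range fun n => e n x) = Submodule.span ℂ (Set.range fun n => v n x) :=
  ⟨fun n x => GreedyOrthonormal.basis (fun k => v k x) n,
    fun n => GreedyOrthonormal.measurable_basis hv n,
    fun _ => ⟨GreedyOrthonormal.isInitialOrthonormal_basis _, GreedyOrthonormal.span_basis _⟩⟩

/-- A measurable range function has a measurable field of orthonormal bases. -/
lemma MeasurableRangeFunction.exists_orthonormal_field [MeasurableSpace H] [BorelSpace H]
    {J : X → ClosedSubmodule ℂ H} (hJ : MeasurableRangeFunction J) :
    ∃ e : ℕ → X → H, (∀ n, Measurable (e n)) ∧ ∀ x, IsInitialOrthonormal (fun n => e n x) ∧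
      (Submodule.span ℂ (Set.range fun n => e n x)).topologicalClosure = (J x).toSubmodule := by
  -- The projections of a dense sequence are dense in `J x`, and they are measurable in `x` by the
  -- definition of a measurable range function.
  let u := TopologicalSpace.denseSeq H
  obtain ⟨e, hm, he⟩ := exists_orthonormal_field_of_measurable
    (v := fun k x => (J x).toSubmodule.starProjection (u k))
    (fun k => measurable_of_inner fun v => hJ (u k) v)
  refine ⟨e, hm, fun x => ⟨(he x).1, ?_⟩⟩
  rw [(he x).2]
  refine le_antisymm (Submodule.topologicalClosure_minimal _ (Submodule.span_le.2 ?_)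
    (J x).isClosed) fun h hh => ?_
  · rintro _ ⟨k, rfl⟩
    exact Submodule.starProjection_apply_mem _ _
  · have h1 : (J x).toSubmodule.starProjection h = h :=
      Submodule.starProjection_eq_self_iff.2 hh
    rw [← h1]
    refine map_mem_closure ((J x).toSubmodule.starProjection).continuous
      (TopologicalSpace.denseRange_denseSeq H h) ?_
    rintro _ ⟨k, rfl⟩
    exact Submodule.subset_span ⟨k, rfl⟩

/-- The closed spans of an orthonormal field form a measurable range function. -/
lemma measurableRangeFunction_of_orthonormal_field [MeasurableSpace H] [BorelSpace H]
    {J : X → ClosedSubmodule ℂ H} {e : ℕ → X → H} (hm : ∀ n, Measurable (e n))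
    (he : ∀ x, IsInitialOrthonormal (fun n => e n x) ∧
      (Submodule.span ℂ (Set.range fun n => e n x)).topologicalClosure = (J x).toSubmodule) :
    MeasurableRangeFunction J := by
  intro u v
  have h : Measurable fun x => (J x).toSubmodule.starProjection u := by
    refine measurable_of_tendsto_metrizable
      (f := fun N x => ∑ n ∈ Finset.range N, inner ℂ (e n x) u • e n x) (fun N => ?_)
      (tendsto_pi_nhds.2 fun x => ((he x).1.hasSum_starProjection (he x).2 u).tendsto_sum_nat)
    exact Finset.measurable_fun_sum _ fun n _ => ((hm n).inner_const).smul (hm n)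
  exact h.const_inner

end OrthonormalFields

/-! ### Fields of contractions acting on `L²`. -/

section FieldsOfOperators

variable {X : Type*} [MeasurableSpace X] {μ : Measure X} {H : Type*} [NormedAddCommGroup H]
  [InnerProductSpace ℂ H]

/-- No measurability of `x ↦ U x` is assumed, so `U` may come from pointwise choice; the series
expansion supplies it. -/
lemma aestronglyMeasurable_of_hasSum {e e' : ℕ → X → H} {U : X → H →L[ℂ] H}
    (hm : ∀ n, AEStronglyMeasurable (e n) μ) (hm' : ∀ n, AEStronglyMeasurable (e' n) μ)
    (hU : ∀ᵐ x ∂μ, ∀ h, HasSum (fun n => inner ℂ (e n x) h • e' n x) (U x h))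
    {f : X → H} (hf : AEStronglyMeasurable f μ) :
    AEStronglyMeasurable (fun x => U x (f x)) μ := by
  refine aestronglyMeasurable_of_tendsto_ae Filter.atTop
    (f := fun N x => ∑ n ∈ Finset.range N, inner ℂ (e n x) (f x) • e' n x) (fun N => ?_) ?_
  · exact Finset.aestronglyMeasurable_fun_sum _ fun n _ => ((hm n).inner hf).smul (hm' n)
  · filter_upwards [hU] with x hx using (hx (f x)).tendsto_sum_nat

/-- A measurable field of contractions acts on `L²`. -/
lemma exists_Lp_map_of_field (U : X → H →L[ℂ] H)
    (hm : ∀ f : Lp H 2 μ, AEStronglyMeasurable (fun x => U x (f x)) μ)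
    (hb : ∀ᵐ x ∂μ, ∀ h, ‖U x h‖ ≤ ‖h‖) :
    ∃ T : Lp H 2 μ →ₗ[ℂ] Lp H 2 μ, ∀ f, T f =ᵐ[μ] fun x => U x (f x) := by
  have hmem : ∀ f : Lp H 2 μ, MemLp (fun x => U x (f x)) 2 μ := fun f =>
    (Lp.memLp f).mono (hm f) (hb.mono fun x hx => hx (f x))
  refine ⟨⟨⟨fun f => (hmem f).toLp _, fun f g => ?_⟩, fun c f => ?_⟩, fun f => (hmem f).coeFn_toLp⟩
  · refine Lp.ext ?_
    filter_upwards [(hmem (f + g)).coeFn_toLp, (hmem f).coeFn_toLp, (hmem g).coeFn_toLp,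
      Lp.coeFn_add f g, Lp.coeFn_add ((hmem f).toLp _) ((hmem g).toLp _)] with x h1 h2 h3 h4 h5
    simp only [h1, h5, Pi.add_apply, h2, h3, h4, map_add]
  · refine Lp.ext ?_
    filter_upwards [(hmem (c • f)).coeFn_toLp, (hmem f).coeFn_toLp,
      Lp.coeFn_smul c f, Lp.coeFn_smul c ((hmem f).toLp _)] with x h1 h2 h3 h4
    simp only [h1, RingHom.id_apply, h4, Pi.smul_apply, h2, h3, map_smul]

end FieldsOfOperators

/-! ### From global to pointwise statements via indicators. -/

section Localization

variable {X : Type*} [MeasurableSpace X] {μ : Measure X} {H : Type*} [NormedAddCommGroup H]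
  [InnerProductSpace ℂ H]

lemma coeFn_indicatorConstLp_smul {A : Set X} (hA : MeasurableSet A) (hμA : μ A ≠ ∞)
    (f : Lp H 2 μ) :
    ((indicatorConstLp ∞ hA hμA (1 : ℂ) : Lp ℂ ∞ μ) • f : Lp H 2 μ) =ᵐ[μ] A.indicator f := by
  filter_upwards [Lp.coeFn_lpSMul (r := 2) (indicatorConstLp ∞ hA hμA (1 : ℂ)) f,
    indicatorConstLp_coeFn (p := ∞) (hs := hA) (hμs := hμA) (c := (1 : ℂ))] with x h1 h2
  rw [h1, Pi.smul_apply', h2]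
  by_cases hx : x ∈ A <;> simp [hx]

lemma inner_indicatorConstLp_smul {A : Set X} (hA : MeasurableSet A) (hμA : μ A ≠ ∞)
    (f g : Lp H 2 μ) :
    inner ℂ ((indicatorConstLp ∞ hA hμA (1 : ℂ) : Lp ℂ ∞ μ) • f : Lp H 2 μ) g =
      ∫ x in A, inner ℂ (f x) (g x) ∂μ := by
  rw [L2.inner_def, ← integral_indicator hA]
  refine integral_congr_ae ?_
  filter_upwards [coeFn_indicatorConstLp_smul hA hμA f] with x hx
  rw [hx]
  by_cases hxA : x ∈ A <;> simp [hxA]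

/-- If all localizations of `f` are orthogonal to `g`, then `f` and `g` are pointwise
orthogonal. -/
lemma ae_inner_eq_zero_of_forall_indicator (f g : Lp H 2 μ)
    (h : ∀ (A : Set X) (hA : MeasurableSet A) (hμA : μ A ≠ ∞),
      inner ℂ ((indicatorConstLp ∞ hA hμA (1 : ℂ) : Lp ℂ ∞ μ) • f : Lp H 2 μ) g = 0) :
    ∀ᵐ x ∂μ, inner ℂ (f x) (g x) = 0 :=
  Integrable.ae_eq_zero_of_forall_setIntegral_eq_zero (L2.integrable_inner (𝕜 := ℂ) f g)
    fun A hA hμA => by rw [← inner_indicatorConstLp_smul hA hμA.ne]; exact h A hA hμA.ne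

lemma enorm_indicatorConstLp_smul_sq {A : Set X} (hA : MeasurableSet A) (hμA : μ A ≠ ∞)
    (f : Lp H 2 μ) :
    ‖((indicatorConstLp ∞ hA hμA (1 : ℂ) : Lp ℂ ∞ μ) • f : Lp H 2 μ)‖ₑ ^ 2 =
      ∫⁻ x in A, ‖f x‖ₑ ^ 2 ∂μ := by
  rw [Lp.enorm_def, eLpNorm_congr_ae (coeFn_indicatorConstLp_smul hA hμA f),
    eLpNorm_indicator_eq_eLpNorm_restrict hA]
  simpa using eLpNorm_nnreal_pow_eq_lintegral (f := f) (μ := μ.restrict A) (p := 2) two_ne_zero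

variable {H' : Type*} [NormedAddCommGroup H'] [InnerProductSpace ℂ H']
  {V : Submodule ℂ (Lp H 2 μ)} {V' : Submodule ℂ (Lp H' 2 μ)}

/-- MI operators are pointwise bounded by their norm. -/
lemma IsMIOperator.ae_norm_le [SigmaFinite μ] {hV : IsMISpace V} {hV' : IsMISpace V'}
    {T : V →L[ℂ] V'} (hT : IsMIOperator hV hV' T) (f : V) :
    ∀ᵐ x ∂μ, ‖(T f : Lp H' 2 μ) x‖ ≤ ‖T‖ * ‖(f : Lp H 2 μ) x‖ := by
  have key : (fun x => ‖(T f : Lp H' 2 μ) x‖ₑ ^ 2) ≤ᵐ[μ]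
      fun x => ‖T‖ₑ ^ 2 * ‖(f : Lp H 2 μ) x‖ₑ ^ 2 := by
    -- As `T` commutes with the indicator of `A`, the bound `‖1_A T f‖ ≤ ‖T‖ ‖1_A f‖` holds for
    -- every `A` of finite measure; its square compares the integrals over `A`.
    refine ae_le_of_forall_setLIntegral_le_of_sigmaFinite
      ((Lp.stronglyMeasurable (T f : Lp H' 2 μ)).enorm.pow_const 2) fun A hA hμA => ?_
    rw [lintegral_const_mul' _ _ (by simp), ← enorm_indicatorConstLp_smul_sq hA hμA.ne,
      ← enorm_indicatorConstLp_smul_sq hA hμA.ne, ← mul_pow]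
    gcongr
    have h := hT (indicatorConstLp ∞ hA hμA.ne (1 : ℂ)) f
    have h2 := T.le_opENorm (hV.mul (indicatorConstLp ∞ hA hμA.ne (1 : ℂ)) f)
    rw [h] at h2
    exact h2
  filter_upwards [key] with x hx
  rw [← mul_pow] at hx
  have h := le_of_not_gt fun hlt => hx.not_gt (ENNReal.pow_lt_pow_left two_ne_zero hlt)
  have h' := ENNReal.toReal_mono (by simp [ENNReal.mul_eq_top]) h
  simpa using h'

end Localization

/-! ### Existence of range functions. -/

section RangeFunctions

variable {X : Type*} [MeasurableSpace X] {μ : Measure X} {H : Type*} [NormedAddCommGroup H]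
  [InnerProductSpace ℂ H]

/-- Multiplying by this weight makes a bounded measurable field square integrable; positivity keeps
the pointwise spans and linear independence. -/
lemma exists_pos_memLp_two (μ : Measure X) [SigmaFinite μ] :
    ∃ g : X → ℝ, (∀ x, 0 < g x) ∧ Measurable g ∧ MemLp g 2 μ := by
  obtain ⟨g, hpos, hm, hint⟩ := exists_pos_lintegral_lt_of_sigmaFinite μ one_ne_zero
  have hm' : Measurable fun x => √(g x : ℝ) := (measurable_coe_nnreal_real.comp hm).sqrt
  refine ⟨fun x => √(g x), fun x => Real.sqrt_pos.2 (NNReal.coe_pos.2 (hpos x)), hm',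
    (memLp_two_iff_integrable_sq hm'.aestronglyMeasurable).2 ?_⟩
  simp only [Real.sq_sqrt (NNReal.coe_nonneg _)]
  refine ⟨(measurable_coe_nnreal_real.comp hm).aestronglyMeasurable, ?_⟩
  simpa [HasFiniteIntegral] using hint.trans ENNReal.one_lt_top

lemma MeasureTheory.MemLp.ofReal_smul {g : X → ℝ} (hg : MemLp g 2 μ) {h : X → H}
    (hh : AEStronglyMeasurable h μ) {C : ℝ} (hC : ∀ x, ‖h x‖ ≤ C) :
    MemLp (fun x => (g x : ℂ) • h x) 2 μ := by
  refine MemLp.of_le_mul hg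
    ((Complex.continuous_ofReal.comp_aestronglyMeasurable hg.1).smul hh) (c := C)
    (Filter.Eventually.of_forall fun x => ?_)
  rw [norm_smul, Complex.norm_real, mul_comm]
  exact mul_le_mul_of_nonneg_right (hC x) (norm_nonneg _)

lemma coeFn_sum_smul {ι : Type*} (s : Finset ι) (c : ι → ℂ) (F : ι → Lp H 2 μ) :
    ∀ᵐ x ∂μ, (∑ i ∈ s, c i • F i : Lp H 2 μ) x = ∑ i ∈ s, c i • F i x := by
  classical
  induction s using Finset.induction_on with
  | empty =>
    filter_upwards [Lp.coeFn_zero H 2 μ] with x hx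
    simpa using hx
  | insert a s ha ih =>
    filter_upwards [ih, Lp.coeFn_add (c a • F a) (∑ i ∈ s, c i • F i),
      Lp.coeFn_smul (c a) (F a)] with x h1 h2 h3
    rw [Finset.sum_insert ha, Finset.sum_insert ha, h2, Pi.add_apply, h1, h3, Pi.smul_apply]

variable {V V' : Submodule ℂ (Lp H 2 μ)}

lemma IsMISpace.indicator_smul_mem (hV : IsMISpace V) {f : Lp H 2 μ} (hf : f ∈ V) {A : Set X}
    (hA : MeasurableSet A) (hμA : μ A ≠ ∞) :
    ((indicatorConstLp ∞ hA hμA (1 : ℂ) : Lp ℂ ∞ μ) • f : Lp H 2 μ) ∈ V := hV.2 _ _ hf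

lemma IsMIOperator.symm {hV : IsMISpace V} {hV' : IsMISpace V'} {T : V ≃L[ℂ] V'}
    (hT : IsMIOperator hV hV' (T : V →L[ℂ] V')) :
    IsMIOperator hV' hV (T.symm : V' →L[ℂ] V) := fun φ f => by
  have := hT φ (T.symm f)
  simp only [ContinuousLinearEquiv.coe_coe, ContinuousLinearEquiv.apply_symm_apply] at this ⊢
  rw [← this, ContinuousLinearEquiv.symm_apply_apply]

variable [CompleteSpace H] [TopologicalSpace.SeparableSpace H]

omit [CompleteSpace H] [TopologicalSpace.SeparableSpace H] in
lemma ClosedSubmodule.mem_orthogonal_of_span {K : ClosedSubmodule ℂ H} {v : ℕ → H}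
    (hK : (Submodule.span ℂ (Set.range v)).topologicalClosure = K.toSubmodule) {h : H}
    (hv : ∀ n, inner ℂ (v n) h = 0) : h ∈ K.toSubmoduleᗮ := by
  rw [← hK, Submodule.orthogonal_closure, Submodule.mem_orthogonal]
  intro u hu
  induction hu using Submodule.span_induction with
  | mem u hu => obtain ⟨n, rfl⟩ := hu; exact hv n
  | zero => exact inner_zero_left _
  | add u w _ _ hu hw => rw [inner_add_left, hu, hw, add_zero]
  | smul c u _ hu => rw [inner_smul_left, hu, mul_zero]

/-- Every MI space has a range function. -/
theorem IsMISpace.exists_isRangeFunctionOf [SigmaFinite μ] (hV : IsMISpace V) :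
    ∃ J : X → ClosedSubmodule ℂ H, IsRangeFunctionOf J V := by
  borelize H
  have hcomp : CompleteSpace V := hV.1.completeSpace_coe
  obtain ⟨g, hgpos, -, hgL⟩ := exists_pos_memLp_two μ
  let u := TopologicalSpace.denseSeq H
  have hG : ∀ n, MemLp (fun x => (g x : ℂ) • u n) 2 μ := fun n =>
    hgL.ofReal_smul aestronglyMeasurable_const fun _ => le_rfl
  let G : ℕ → Lp H 2 μ := fun n => (hG n).toLp _
  let F : ℕ → Lp H 2 μ := fun n => V.starProjection (G n)
  have hFV : ∀ n, F n ∈ V := fun n => Submodule.starProjection_apply_mem _ _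
  let J : X → ClosedSubmodule ℂ H := fun x =>
    ⟨(Submodule.span ℂ (Set.range fun n => F n x)).topologicalClosure,
      Submodule.isClosed_topologicalClosure _⟩
  have hJF : ∀ x, (Submodule.span ℂ (Set.range fun n => F n x)).topologicalClosure =
    (J x).toSubmodule := fun x => rfl
  obtain ⟨e, hem, he⟩ := exists_orthonormal_field_of_measurable
    (v := fun n x => F n x) fun n => (Lp.stronglyMeasurable (F n)).measurable
  have he' : ∀ x, IsInitialOrthonormal (fun n => e n x) ∧
      (Submodule.span ℂ (Set.range fun n => e n x)).topologicalClosure = (J x).toSubmodule :=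
    fun x => ⟨(he x).1, by rw [(he x).2]⟩
  -- Since `V` is closed, it suffices to test against `h ⟂ V`. Such an `h` is orthogonal to all
  -- localizations of `F n`, hence pointwise orthogonal to `J x`.
  have hsub : ∀ f : Lp H 2 μ, (∀ᵐ x ∂μ, f x ∈ J x) → f ∈ V := by
    intro f hf
    rw [← Submodule.orthogonal_orthogonal V]
    intro h hh
    have h0 : ∀ᵐ x ∂μ, ∀ n, inner ℂ (F n x) (h x) = 0 := by
      refine ae_all_iff.2 fun n => ae_inner_eq_zero_of_forall_indicator _ _ fun A hA hμA => ?_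
      exact hh _ (hV.indicator_smul_mem (hFV n) hA hμA)
    rw [L2.inner_def]
    refine integral_eq_zero_of_ae ?_
    filter_upwards [h0, hf] with x hx hfx
    exact Submodule.inner_left_of_mem_orthogonal (K := (J x).toSubmodule) hfx
      (ClosedSubmodule.mem_orthogonal_of_span (hJF x) hx)
  refine ⟨J, measurableRangeFunction_of_orthonormal_field hem he', fun f => ⟨fun hf => ?_, hsub f⟩⟩
  obtain ⟨P, hP⟩ := exists_Lp_map_of_field (μ := μ) (fun x => (J x).toSubmodule.starProjection)
    (fun f => aestronglyMeasurable_of_hasSum (e := e) (e' := e)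
      (fun n => (hem n).aestronglyMeasurable) (fun n => (hem n).aestronglyMeasurable)
      (Filter.Eventually.of_forall fun x => (he' x).1.hasSum_starProjection (he' x).2)
      (Lp.aestronglyMeasurable f))
    (Filter.Eventually.of_forall fun x h => Submodule.norm_starProjection_apply_le _ h)
  have hPf : P f ∈ V := hsub _ <| (hP f).mono fun x hx => by
    rw [hx]
    exact Submodule.starProjection_apply_mem _ _
  have hdiff : ∀ᵐ x ∂μ, (f - P f : Lp H 2 μ) x ∈ (J x).toSubmoduleᗮ := by
    filter_upwards [hP f, Lp.coeFn_sub f (P f)] with x h1 h2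
    rw [h2, Pi.sub_apply, h1]
    exact Submodule.sub_starProjection_mem_orthogonal _
  -- Localizations of `f - P f` stay in `V`, so pairing them with `G n` is the same as pairing them
  -- with its projection `F n`, and `F n x ∈ J x` is orthogonal to `(f - P f) x`.
  have hG0 : ∀ᵐ x ∂μ, ∀ n, inner ℂ ((f - P f : Lp H 2 μ) x) (G n x) = 0 := by
    refine ae_all_iff.2 fun n => ae_inner_eq_zero_of_forall_indicator _ _ fun A hA hμA => ?_
    have hmem := hV.indicator_smul_mem (V.sub_mem hf hPf) hA hμA
    have h1 : inner ℂ ((indicatorConstLp ∞ hA hμA (1 : ℂ) : Lp ℂ ∞ μ) • (f - P f) : Lp H 2 μ)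
        (G n - F n) = 0 :=
      Submodule.inner_right_of_mem_orthogonal hmem
        (Submodule.sub_starProjection_mem_orthogonal (G n))
    rw [inner_sub_right, sub_eq_zero] at h1
    rw [h1, inner_indicatorConstLp_smul]
    refine integral_eq_zero_of_ae (ae_restrict_of_ae ?_)
    filter_upwards [hdiff] with x hx
    exact Submodule.inner_left_of_mem_orthogonal (K := (J x).toSubmodule)
      (Submodule.le_topologicalClosure _ (Submodule.subset_span ⟨n, rfl⟩)) hx
  have hGn : ∀ᵐ x ∂μ, ∀ n, G n x = (g x : ℂ) • u n := ae_all_iff.2 fun n => (hG n).coeFn_toLp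
  filter_upwards [hP f, Lp.coeFn_sub f (P f), hG0, hGn] with x h1 h2 h3 h4
  have hz : (f - P f : Lp H 2 μ) x = 0 := by
    refine (TopologicalSpace.denseRange_denseSeq H).eq_zero_of_inner_left ℂ fun n => ?_
    have := h3 n
    rw [h4, inner_smul_right] at this
    exact (mul_eq_zero.1 this).resolve_left (Complex.ofReal_ne_zero.2 (hgpos x).ne')
  rw [h2, Pi.sub_apply, h1, sub_eq_zero] at hz
  rw [hz]
  exact Submodule.starProjection_apply_mem _ _

/-! ### Dimension functions and MI isomorphisms. -/

/-- MI isomorphisms do not decrease the dimension function. -/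
theorem IsMIOperator.ae_rank_le [SigmaFinite μ] {hV : IsMISpace V} {hV' : IsMISpace V'}
    {J J' : X → ClosedSubmodule ℂ H} (hJ : IsRangeFunctionOf J V) (hJ' : IsRangeFunctionOf J' V')
    {T : V ≃L[ℂ] V'} (hT : IsMIOperator hV hV' (T : V →L[ℂ] V')) :
    ∀ᵐ x ∂μ, Cardinal.toENat (Module.rank ℂ (J x).toSubmodule) ≤
      Cardinal.toENat (Module.rank ℂ (J' x).toSubmodule) := by
  borelize H
  obtain ⟨e, hem, he⟩ := hJ.1.exists_orthonormal_field
  obtain ⟨g, hgpos, -, hgL⟩ := exists_pos_memLp_two μ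
  have heJ : ∀ x n, e n x ∈ J x := fun x n => by
    rw [← ClosedSubmodule.mem_toSubmodule_iff, ← (he x).2]
    exact Submodule.le_topologicalClosure _ (Submodule.subset_span ⟨n, rfl⟩)
  have hF : ∀ n, MemLp (fun x => (g x : ℂ) • e n x) 2 μ := fun n =>
    hgL.ofReal_smul (hem n).aestronglyMeasurable (C := 1) fun x => by
      by_cases h : e n x = 0
      · simp [h]
      · exact ((he x).1.norm_eq_one n h).le
  have hFV : ∀ n, (hF n).toLp _ ∈ V := fun n => (hJ.2 _).2 <| (hF n).coeFn_toLp.mono fun x hx => by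
    rw [hx]
    exact (J x).toSubmodule.smul_mem _ (heJ x n)
  let F : ℕ → V := fun n => ⟨(hF n).toLp _, hFV n⟩
  have hFe : ∀ᵐ x ∂μ, ∀ n, (F n : Lp H 2 μ) x = (g x : ℂ) • e n x :=
    ae_all_iff.2 fun n => (hF n).coeFn_toLp
  have hTJ : ∀ᵐ x ∂μ, ∀ n, (T (F n) : Lp H 2 μ) x ∈ J' x :=
    ae_all_iff.2 fun n => (hJ'.2 _).1 (T (F n)).2
  -- The exceptional null set depends on the coefficients, so only countably many coefficient
  -- vectors are treated here; continuity then extends the bound to all of them.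
  have key : ∀ᵐ x ∂μ, ∀ (N k : ℕ),
      ‖∑ i, TopologicalSpace.denseSeq (Fin N → ℂ) k i • (F i : Lp H 2 μ) x‖ ≤
        ‖(T.symm : V' →L[ℂ] V)‖ *
          ‖∑ i, TopologicalSpace.denseSeq (Fin N → ℂ) k i • (T (F i) : Lp H 2 μ) x‖ := by
    refine ae_all_iff.2 fun N => ae_all_iff.2 fun k => ?_
    set c := TopologicalSpace.denseSeq (Fin N → ℂ) k
    have hb := hT.symm.ae_norm_le (T (∑ i, c i • F i))
    filter_upwards [hb, coeFn_sum_smul Finset.univ c fun i => (F i : Lp H 2 μ),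
      coeFn_sum_smul Finset.univ c fun i => (T (F i) : Lp H 2 μ)] with x h1 h2 h3
    simp only [ContinuousLinearEquiv.coe_coe, ContinuousLinearEquiv.symm_apply_apply, map_sum,
      map_smul, Submodule.coe_sum, Submodule.coe_smul] at h1
    rwa [h2, h3] at h1
  filter_upwards [hFe, hTJ, key] with x h1 h2 h3
  have h4 : ∀ (N : ℕ) (c : Fin N → ℂ), ‖∑ i, c i • (F i : Lp H 2 μ) x‖ ≤
      ‖(T.symm : V' →L[ℂ] V)‖ * ‖∑ i, c i • (T (F i) : Lp H 2 μ) x‖ := fun N c => by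
    have hcl : IsClosed {c : Fin N → ℂ | ‖∑ i, c i • (F i : Lp H 2 μ) x‖ ≤
        ‖(T.symm : V' →L[ℂ] V)‖ * ‖∑ i, c i • (T (F i) : Lp H 2 μ) x‖} :=
      isClosed_le (by fun_prop) (by fun_prop)
    refine closure_minimal ?_ hcl (TopologicalSpace.denseRange_denseSeq (Fin N → ℂ) c)
    rintro _ ⟨k, rfl⟩
    exact h3 N k
  refine ENat.forall_natCast_le_iff_le.1 fun N hN => ?_
  rw [Cardinal.natCast_le_toENat]
  cases N with
  | zero => simp
  | succ n =>
    have hn : e n x ≠ 0 := ((he x).1.ne_zero_iff_le_rank (he x).2 n).2 hN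
    have hne : ∀ i ∈ {i | i < n + 1}, e i x ≠ 0 := fun i hi h =>
      hn ((he x).1.eq_zero_of_le i n (Nat.lt_succ_iff.1 hi) h)
    have hle : LinearIndependent ℂ fun i : Fin (n + 1) => e i x :=
      ((he x).1.orthonormal hne).linearIndependent.comp
        (fun i : Fin (n + 1) => (⟨i, i.2⟩ : {i | i < n + 1}))
        fun i j hij => Fin.ext (congrArg Subtype.val hij)
    have hli : LinearIndependent ℂ
        fun i : Fin (n + 1) => (⟨(T (F i) : Lp H 2 μ) x, h2 i⟩ : (J' x).toSubmodule) := by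
      refine LinearIndependent.of_comp (J' x).toSubmodule.subtype ?_
      -- By the lower bound `h4`, a relation among the values of `T (F i)` at `x` is also a relation
      -- among the vectors `g x • e i x`, which are independent.
      refine Fintype.linearIndependent_iff.2 fun c hc i => ?_
      have h5 := h4 (n + 1) c
      simp only [Function.comp_apply, Submodule.subtype_apply] at hc
      rw [hc, norm_zero, mul_zero] at h5
      have h6 := norm_le_zero_iff.1 h5
      simp only [h1, smul_smul] at h6
      have := Fintype.linearIndependent_iff.1 hle _ h6 i
      exact (mul_eq_zero.1 this).resolve_right (Complex.ofReal_ne_zero.2 (hgpos x).ne')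
    simpa using hli.cardinal_lift_le_rank

/-- MI spaces with the same dimension function are isometrically MI isomorphic. -/
theorem exists_isometricMIIsomorphism {hV : IsMISpace V} {hV' : IsMISpace V'}
    {J J' : X → ClosedSubmodule ℂ H} (hJ : IsRangeFunctionOf J V) (hJ' : IsRangeFunctionOf J' V')
    (hd : ∀ᵐ x ∂μ, Cardinal.toENat (Module.rank ℂ (J x).toSubmodule) =
      Cardinal.toENat (Module.rank ℂ (J' x).toSubmodule)) :
    ∃ T : V ≃ₗᵢ[ℂ] V', IsMIOperator hV hV' (T.toContinuousLinearEquiv : V →L[ℂ] V') := by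
  borelize H
  obtain ⟨e, hem, he⟩ := hJ.1.exists_orthonormal_field
  obtain ⟨e', hem', he'⟩ := hJ'.1.exists_orthonormal_field
  have hz : ∀ᵐ x ∂μ, ∀ n, e n x = 0 ↔ e' n x = 0 := hd.mono fun x hx n => by
    rw [← not_iff_not]
    exact ((he x).1.ne_zero_iff_le_rank (he x).2 n).trans
      (hx ▸ ((he' x).1.ne_zero_iff_le_rank (he' x).2 n).symm)
  -- The matching condition is a premise inside the existential so that `choose` applies at every
  -- `x`; on the exceptional null set the operators are `0`.
  have hW : ∀ x, ∃ W W' : H →L[ℂ] H, (∀ n, e n x = 0 ↔ e' n x = 0) →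
      (∀ h, ‖W h‖ ≤ ‖h‖) ∧ (∀ h, ‖W' h‖ ≤ ‖h‖) ∧
      (∀ h, HasSum (fun n => inner ℂ (e n x) h • e' n x) (W h)) ∧
      (∀ h, HasSum (fun n => inner ℂ (e' n x) h • e n x) (W' h)) ∧
      (∀ h, W h ∈ J' x) ∧ (∀ h, W' h ∈ J x) ∧
      (∀ h ∈ J x, W' (W h) = h) ∧ (∀ h ∈ J' x, W (W' h) = h) := fun x => by
    by_cases h : ∀ n, e n x = 0 ↔ e' n x = 0
    · have := (he x).1.exists_transfer (he' x).1 h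
      rw [(he x).2, (he' x).2] at this
      obtain ⟨W, W', hW⟩ := this
      exact ⟨W, W', fun _ => hW⟩
    · exact ⟨0, 0, fun h' => absurd h' h⟩
  choose W W' hW using hW
  obtain ⟨T, hT⟩ := exists_Lp_map_of_field (μ := μ) W
    (fun f => aestronglyMeasurable_of_hasSum (fun n => (hem n).aestronglyMeasurable)
      (fun n => (hem' n).aestronglyMeasurable) (hz.mono fun x hx => (hW x hx).2.2.1)
      (Lp.aestronglyMeasurable f)) (hz.mono fun x hx => (hW x hx).1)
  obtain ⟨T', hT'⟩ := exists_Lp_map_of_field (μ := μ) W'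
    (fun f => aestronglyMeasurable_of_hasSum (fun n => (hem' n).aestronglyMeasurable)
      (fun n => (hem n).aestronglyMeasurable) (hz.mono fun x hx => (hW x hx).2.2.2.1)
      (Lp.aestronglyMeasurable f)) (hz.mono fun x hx => (hW x hx).2.1)
  have hTV : ∀ f ∈ V, T f ∈ V' := fun f _ => (hJ'.2 _).2 <| by
    filter_upwards [hT f, hz] with x h1 h2
    exact h1 ▸ (hW x h2).2.2.2.2.1 _
  have hTV' : ∀ f ∈ V', T' f ∈ V := fun f _ => (hJ.2 _).2 <| by
    filter_upwards [hT' f, hz] with x h1 h2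
    exact h1 ▸ (hW x h2).2.2.2.2.2.1 _
  have hinv : ∀ f ∈ V, T' (T f) = f := fun f hf => Lp.ext <| by
    filter_upwards [hT' (T f), hT f, hz, (hJ.2 f).1 hf] with x h1 h2 h3 h4
    rw [h1, h2, (hW x h3).2.2.2.2.2.2.1 _ h4]
  have hinv' : ∀ f ∈ V', T (T' f) = f := fun f hf => Lp.ext <| by
    filter_upwards [hT (T' f), hT' f, hz, (hJ'.2 f).1 hf] with x h1 h2 h3 h4
    rw [h1, h2, (hW x h3).2.2.2.2.2.2.2 _ h4]
  have hle : ∀ f, ‖T f‖ ≤ ‖f‖ := fun f => Lp.norm_le_norm_of_ae_le <| by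
    filter_upwards [hT f, hz] with x h1 h2
    exact h1 ▸ (hW x h2).1 _
  have hle' : ∀ f, ‖T' f‖ ≤ ‖f‖ := fun f => Lp.norm_le_norm_of_ae_le <| by
    filter_upwards [hT' f, hz] with x h1 h2
    exact h1 ▸ (hW x h2).2.1 _
  refine ⟨⟨LinearEquiv.ofLinearMap (T.restrict hTV) (T'.restrict hTV')
    (LinearMap.ext fun f => Subtype.ext (hinv' f f.2))
    (LinearMap.ext fun f => Subtype.ext (hinv f f.2)), fun f => ?_⟩, fun φ f => Subtype.ext ?_⟩
  -- Two mutually inverse contractions are isometries.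
  · refine le_antisymm (hle f) ?_
    conv_lhs => rw [← Submodule.norm_coe, ← hinv f f.2]
    exact hle' _
  · change T (φ • (f : Lp H 2 μ)) = (φ • T f : Lp H 2 μ)
    refine Lp.ext ?_
    filter_upwards [hT (φ • (f : Lp H 2 μ)), hT f, Lp.coeFn_lpSMul (r := 2) φ (f : Lp H 2 μ),
      Lp.coeFn_lpSMul (r := 2) φ (T f)] with x h1 h2 h3 h4
    rw [h1, h3, h4, Pi.smul_apply', Pi.smul_apply', h2, map_smul]

end RangeFunctions

theorem mainTheorem6 {X : Type*} [MeasurableSpace X] (μ : Measure X) [SigmaFinite μ]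
    [μ.IsComplete] [TopologicalSpace.SeparableSpace (Lp ℂ 2 μ)]
    {H : Type*} [NormedAddCommGroup H] [InnerProductSpace ℂ H] [CompleteSpace H]
    [TopologicalSpace.SeparableSpace H]
    (V V' : Submodule ℂ (Lp H 2 μ)) (hV : IsMISpace V) (hV' : IsMISpace V') :
    (∃ d : X → ℕ∞, IsDimensionFunctionOf d V) ∧
    (∃ d' : X → ℕ∞, IsDimensionFunctionOf d' V') ∧
    ∀ d d' : X → ℕ∞, IsDimensionFunctionOf d V → IsDimensionFunctionOf d' V' →
      List.TFAE [
        ∀ᵐ x ∂μ, d x = d' x,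
        ∃ T : V ≃ₗᵢ[ℂ] V', IsMIOperator hV hV' (T.toContinuousLinearEquiv : V →L[ℂ] V'),
        ∃ T : V ≃L[ℂ] V', IsMIOperator hV hV' (T : V →L[ℂ] V')] := by
  obtain ⟨J₀, hJ₀⟩ := hV.exists_isRangeFunctionOf
  obtain ⟨J₀', hJ₀'⟩ := hV'.exists_isRangeFunctionOf
  refine ⟨⟨_, J₀, hJ₀, fun _ => rfl⟩, ⟨_, J₀', hJ₀', fun _ => rfl⟩, ?_⟩
  rintro d d' ⟨J, hJ, hd⟩ ⟨J', hJ', hd'⟩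
  simp only [hd, hd']
  tfae_have 1 → 2 := exists_isometricMIIsomorphism hJ hJ'
  tfae_have 2 → 3 := fun ⟨T, hT⟩ => ⟨T.toContinuousLinearEquiv, hT⟩
  -- The inequality is applied to `T` and to `T.symm`.
  tfae_have 3 → 1 := fun ⟨T, hT⟩ => by
    filter_upwards [hT.ae_rank_le hJ hJ', hT.symm.ae_rank_le hJ' hJ] with x h1 h2
    exact le_antisymm h1 h2
  tfae_finish
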